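/- For $\nu\in\mathbb C$ let $$j_\nu(z)=(z/2)^{-\nu}J_\nu(z)=\sum_{k=0}^\infty\frac{(-1)^k}{k!\,\Gamma(k+\nu+1)}\Big(\frac z2\Big)^{2k}\qquad(z\in\mathbb C)$$ be the normalized Bessel function of order $\nu$, an entire even function (with $1/\Gamma=0$ at the poles of $\Gamma$). A nonzero complex number $z$ is called $j_\nu$-rational if $z=a/b$ for some zeros $a,b\in\mathbb C$ of $j_\nu$ with $b\neq 0$. A complex number $z$ is called $j_\nu$-Liouville if (i) $z$ is not $j_\nu$-rational, and (ii) for every $N\in\mathbb N$ there are zeros $a,b\in\mathbb C$ of $j_\nu$ with $|b|>1$ and $|z-a/b|<1/|b|^N$. Theorem. For every real $\nu$, the set of real numbers that are $j_\nu$-Liouville is uncountable and dense in $\mathbb R$. -/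

import Mathlib

/-- The normalized Bessel function `j_ν(z) = (z/2)^{-ν} J_ν(z)`, as the entire function given by
its power series `∑ (-1)^k / (k! Γ(k+ν+1)) (z/2)^{2k}`. Mathlib's `Complex.Gamma` is `0` at
the poles of the Gamma function, so `1/Γ` has its usual value `0` there. -/
noncomputable def normalizedBessel (ν z : ℂ) : ℂ :=
  ∑' k : ℕ, (-1) ^ k / ((k.factorial : ℂ) * Complex.Gamma ((k : ℂ) + ν + 1)) * (z / 2) ^ (2 * k)

/-- A nonzero complex number `z` is `j_ν`-rational if `z = a / b` for zeros `a`, `b` of `j_ν`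
with `b ≠ 0`. -/
def IsBesselRational (ν z : ℂ) : Prop :=
  z ≠ 0 ∧ ∃ a b : ℂ, normalizedBessel ν a = 0 ∧ normalizedBessel ν b = 0 ∧ b ≠ 0 ∧ z = a / b

/-- A complex number `z` is `j_ν`-Liouville if it is not `j_ν`-rational and for every `N` there
are zeros `a`, `b` of `j_ν` with `|b| > 1` and `|z - a / b| < 1 / |b| ^ N`. -/
def IsBesselLiouville (ν z : ℂ) : Prop :=
  ¬ IsBesselRational ν z ∧
    ∀ N : ℕ, ∃ a b : ℂ, normalizedBessel ν a = 0 ∧ normalizedBessel ν b = 0 ∧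
      1 < ‖b‖ ∧ ‖z - a / b‖ < 1 / ‖b‖ ^ N

open Filter Topology

/-! The argument is Baire category. For each `N` the approximation condition is open in `x`, and it
holds at every quotient of real zeros with denominator above 1, so it defines a residual set once
such quotients are dense. Excluding the rational points costs only a countable set, since a nonzero
entire function has countably many zeros. Density needs only that real zeros have bounded gaps far
out. This is a Sturm comparison: the Riccati equation of the Bessel equation would blow up on a long
zero-free interval. -/

/-- Coefficients of a power series of infinite radius of convergence. -/
def EntireCoeff (c : ℕ → ℂ) : Prop := ∀ r : ℝ, Summable fun k => ‖c k‖ * r ^ k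

/-- The sum of the power series with coefficients `c`. -/
noncomputable def powerSum (c : ℕ → ℂ) (z : ℂ) : ℂ := ∑' k, c k * z ^ k

/-- Coefficients of the termwise derivative. -/
def derivCoeff (c : ℕ → ℂ) (k : ℕ) : ℂ := (k + 1) * c (k + 1)

/-! ### Entire power series -/

namespace EntireCoeff

variable {c : ℕ → ℂ}

theorem summable (hc : EntireCoeff c) (z : ℂ) : Summable fun k => c k * z ^ k := by
  refine Summable.of_norm ?_
  simpa [norm_mul, norm_pow] using hc ‖z‖

theorem derivCoeff (hc : EntireCoeff c) : EntireCoeff (derivCoeff c) := by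
  intro r
  -- Doubling the radius absorbs the factor `k + 1 ≤ 2 ^ (k + 1)`.
  have h := (summable_nat_add_iff 1).mpr (hc (2 * (|r| + 1)))
  refine Summable.of_norm_bounded h fun k => ?_
  have h1 : ((k : ℝ) + 1) ≤ 2 ^ (k + 1) := by exact_mod_cast (Nat.lt_two_pow_self (n := k + 1)).le
  have h2 : |r| ^ k ≤ (|r| + 1) ^ (k + 1) :=
    calc |r| ^ k ≤ (|r| + 1) ^ k := by gcongr; linarith
      _ ≤ (|r| + 1) ^ (k + 1) := pow_le_pow_right₀ (by linarith [abs_nonneg r]) (by omega)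
  have h3 : ‖((k : ℂ) + 1)‖ = (k : ℝ) + 1 := by
    exact_mod_cast Complex.norm_natCast (k + 1)
  rw [norm_mul, norm_norm, norm_pow, Real.norm_eq_abs, _root_.derivCoeff, norm_mul, h3]
  calc ((k : ℝ) + 1) * ‖c (k + 1)‖ * |r| ^ k
      ≤ 2 ^ (k + 1) * ‖c (k + 1)‖ * (|r| + 1) ^ (k + 1) := by gcongr
    _ = ‖c (k + 1)‖ * (2 * (|r| + 1)) ^ (k + 1) := by rw [mul_pow]; ring

theorem hasDerivAt (hc : EntireCoeff c) (z : ℂ) :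
    HasDerivAt (powerSum c) (powerSum (_root_.derivCoeff c) z) z := by
  have hz : z ∈ Metric.ball (0 : ℂ) (‖z‖ + 1) := by simp
  have hd : ∀ k, DifferentiableOn ℂ (fun w => c k * w ^ k) (Metric.ball (0 : ℂ) (‖z‖ + 1)) :=
    fun k => by fun_prop
  have hb : ∀ (k : ℕ) (w : ℂ), w ∈ Metric.ball (0 : ℂ) (‖z‖ + 1) →
      ‖c k * w ^ k‖ ≤ ‖c k‖ * (‖z‖ + 1) ^ k := fun k w hw => by
    rw [norm_mul, norm_pow]
    have := (mem_ball_zero_iff.mp hw).le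
    gcongr
  have hs := Complex.hasSum_deriv_of_summable_norm (hc _) hd Metric.isOpen_ball hb hz
  have hD := Complex.differentiableOn_tsum_of_summable_norm (hc _) hd Metric.isOpen_ball hb
  have hda := (hD.differentiableAt (Metric.isOpen_ball.mem_nhds hz)).hasDerivAt
  suffices h : deriv (fun w => ∑' k, c k * w ^ k) z = powerSum (_root_.derivCoeff c) z by
    rw [← h]; exact hda
  rw [← hs.tsum_eq, hs.summable.tsum_eq_zero_add]
  simp only [powerSum, _root_.derivCoeff]
  simp
  refine tsum_congr fun k => ?_
  ring

theorem eq_zero_of_powerSum_eq_zero (n : ℕ) : ∀ {c : ℕ → ℂ}, EntireCoeff c →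
    (∀ z, powerSum c z = 0) → c n = 0 := by
  induction n with
  | zero =>
    intro c _ h
    have h0 := h 0
    rw [powerSum, tsum_eq_single 0 (fun k hk => by simp [hk])] at h0
    simpa using h0
  | succ n ih =>
    intro c hc h
    have hd : ∀ z, powerSum (_root_.derivCoeff c) z = 0 := fun z => by
      have h1 := hc.hasDerivAt z
      rw [show powerSum c = fun _ => 0 from funext h] at h1
      exact h1.unique (hasDerivAt_const z 0)
    have := ih hc.derivCoeff hd
    rw [_root_.derivCoeff] at this
    exact (mul_eq_zero.mp this).resolve_left (by exact_mod_cast n.succ_ne_zero)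

end EntireCoeff

/-! ### The Bessel series, its differential equation and its zeros -/

/-- Coefficients of `j_ν` as a power series in `(z / 2) ^ 2`. -/
noncomputable def besselCoeff (ν : ℂ) (k : ℕ) : ℂ :=
  (-1) ^ k / ((k.factorial : ℂ) * Complex.Gamma ((k : ℂ) + ν + 1))

theorem normalizedBessel_eq (ν z : ℂ) :
    normalizedBessel ν z = powerSum (besselCoeff ν) ((z / 2) ^ 2) := by
  simp only [normalizedBessel, powerSum, besselCoeff, pow_mul]

/-- Without division the recurrence survives the poles, because `1/Γ(s) = s/Γ(s+1)` holds for every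
`s`. -/
theorem besselCoeff_succ (ν : ℂ) (k : ℕ) :
    (k + 1) * (k + 1 + ν) * besselCoeff ν (k + 1) = -besselCoeff ν k := by
  have h := Complex.one_div_Gamma_eq_self_mul_one_div_Gamma_add_one ((k : ℂ) + ν + 1)
  have hk : (k.factorial : ℂ) ≠ 0 := by exact_mod_cast k.factorial_ne_zero
  have hk1 : (k : ℂ) + 1 ≠ 0 := by exact_mod_cast k.succ_ne_zero
  have e : ((k + 1 : ℕ) : ℂ) + ν + 1 = (k : ℂ) + ν + 1 + 1 := by push_cast; ring
  simp only [besselCoeff, e, Nat.factorial_succ, div_eq_mul_inv, mul_inv, h]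
  push_cast
  field_simp
  ring

theorem entireCoeff_besselCoeff (ν : ℂ) : EntireCoeff (besselCoeff ν) := by
  intro r
  refine summable_of_ratio_norm_eventually_le (r := 1 / 2) (by norm_num) ?_
  filter_upwards [eventually_ge_atTop (⌈‖ν‖⌉₊), eventually_ge_atTop (⌈2 * |r|⌉₊)] with k h1 h2
  have h1' : ‖ν‖ ≤ k := Nat.ceil_le.mp h1
  have h2' : 2 * |r| ≤ k := Nat.ceil_le.mp h2
  have h3 : ‖((k : ℂ) + 1)‖ = (k : ℝ) + 1 := by
    exact_mod_cast Complex.norm_natCast (k + 1)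
  have h4 : 1 ≤ ‖(k : ℂ) + 1 + ν‖ := by
    have := norm_sub_le_norm_add ((k : ℂ) + 1) ν
    rw [h3] at this; linarith
  have h5 := congrArg norm (besselCoeff_succ ν k)
  rw [norm_mul, norm_mul, norm_neg, h3] at h5
  have h6 : ((k : ℝ) + 1) * ‖besselCoeff ν (k + 1)‖ ≤ ‖besselCoeff ν k‖ := by
    rw [← h5]
    gcongr
    nlinarith
  have h7 : |r| * ‖besselCoeff ν (k + 1)‖ ≤ 1 / 2 * ‖besselCoeff ν k‖ := by
    nlinarith [norm_nonneg (besselCoeff ν (k + 1))]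
  simp only [norm_mul, norm_norm, norm_pow, Real.norm_eq_abs r, pow_succ]
  calc ‖besselCoeff ν (k + 1)‖ * (|r| ^ k * |r|)
      = (|r| * ‖besselCoeff ν (k + 1)‖) * |r| ^ k := by ring
    _ ≤ (1 / 2 * ‖besselCoeff ν k‖) * |r| ^ k := by
        gcongr
    _ = _ := by ring

theorem besselCoeff_ofReal (ν : ℝ) (k : ℕ) : ((besselCoeff ν k).re : ℂ) = besselCoeff ν k := by
  have : besselCoeff ν k =
      (((-1) ^ k / ((k.factorial : ℝ) * Real.Gamma ((k : ℝ) + ν + 1)) : ℝ) : ℂ) := by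
    rw [besselCoeff]
    push_cast [← Complex.Gamma_ofReal]
    rfl
  rw [this, Complex.ofReal_re]

/-- The Bessel differential equation in the variable `w = (z / 2) ^ 2`. -/
theorem powerSum_besselCoeff_ode (ν w : ℂ) :
    w * powerSum (derivCoeff (derivCoeff (besselCoeff ν))) w +
      (ν + 1) * powerSum (derivCoeff (besselCoeff ν)) w + powerSum (besselCoeff ν) w = 0 := by
  set c := besselCoeff ν with hcdef
  have hc : EntireCoeff c := entireCoeff_besselCoeff ν
  have e1 : w * powerSum (derivCoeff (derivCoeff c)) w
      = ∑' k : ℕ, ((k : ℂ) * (k + 1) * c (k + 1)) * w ^ k := by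
    have hs := (hc.derivCoeff.derivCoeff.summable w).mul_left w
    rw [powerSum, ← tsum_mul_left]
    rw [Summable.tsum_eq_zero_add (f := fun k : ℕ => ((k : ℂ) * (k + 1) * c (k + 1)) * w ^ k)]
    · simp only [derivCoeff]
      simp
      refine tsum_congr fun k => ?_
      ring
    · rw [← summable_nat_add_iff 1]
      refine hs.congr fun k => ?_
      simp only [derivCoeff]; push_cast; ring
  have s1 : Summable fun k : ℕ => ((k : ℂ) * (k + 1) * c (k + 1)) * w ^ k := by
    rw [← summable_nat_add_iff 1]
    refine ((hc.derivCoeff.derivCoeff.summable w).mul_left w).congr fun k => ?_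
    simp only [derivCoeff]; push_cast; ring
  have s2 := (hc.derivCoeff.summable w).mul_left (ν + 1)
  have s3 := hc.summable w
  rw [e1, powerSum, powerSum, ← tsum_mul_left, ← s1.tsum_add s2, ← (s1.add s2).tsum_add s3]
  rw [← tsum_zero (β := ℕ)]
  refine tsum_congr fun k => ?_
  have := besselCoeff_succ ν k
  rw [← hcdef] at this
  simp only [derivCoeff]
  linear_combination w ^ k * this

theorem exists_normalizedBessel_ne_zero (ν : ℝ) : ∃ z, normalizedBessel ν z ≠ 0 := by
  by_contra! h
  -- For `k > -ν` the Gamma argument is positive, so this coefficient is nonzero.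
  obtain ⟨k, hk⟩ := exists_nat_gt (-ν)
  have h0 := (entireCoeff_besselCoeff (ν : ℂ)).eq_zero_of_powerSum_eq_zero k (fun w => by
    obtain ⟨u, hu⟩ := IsAlgClosed.exists_pow_nat_eq w (n := 2) (by norm_num)
    have := h (2 * u)
    rwa [normalizedBessel_eq, mul_div_cancel_left₀ _ two_ne_zero, hu] at this)
  have hpos : 0 < Real.Gamma ((k : ℝ) + ν + 1) := Real.Gamma_pos_of_pos (by linarith)
  have hne : Complex.Gamma ((k : ℂ) + ν + 1) ≠ 0 := by
    have := Complex.Gamma_ofReal ((k : ℝ) + ν + 1)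
    push_cast at this
    rw [this]
    exact_mod_cast hpos.ne'
  have hk : (k.factorial : ℂ) ≠ 0 := by exact_mod_cast k.factorial_ne_zero
  simp [besselCoeff, hk, hne] at h0

theorem normalizedBessel_neg (ν z : ℂ) : normalizedBessel ν (-z) = normalizedBessel ν z := by
  simp only [normalizedBessel_eq, neg_div, neg_sq]

theorem differentiable_normalizedBessel (ν : ℂ) : Differentiable ℂ (normalizedBessel ν) := by
  have h : Differentiable ℂ (powerSum (besselCoeff ν)) := fun z =>
    ((entireCoeff_besselCoeff ν).hasDerivAt z).differentiableAt
  rw [show normalizedBessel ν = fun z => powerSum (besselCoeff ν) ((z / 2) ^ 2) from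
    funext (normalizedBessel_eq ν)]
  fun_prop

theorem countable_normalizedBessel_zeros (ν : ℝ) : {z | normalizedBessel ν z = 0}.Countable := by
  obtain ⟨z, hz⟩ := exists_normalizedBessel_ne_zero ν
  have hA : AnalyticOnNhd ℂ (normalizedBessel ν) Set.univ :=
    (differentiable_normalizedBessel ν).differentiableOn.analyticOnNhd isOpen_univ
  have h := hA.preimage_zero_mem_codiscrete hz
  refine (HereditarilyLindelofSpace.isLindelof _).countable_of_isDiscrete
    (isDiscrete_of_codiscreteWithin (U := Set.univ) ?_) |>.mono (Set.subset_inter subset_rfl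
      (Set.subset_univ _))
  exact h

theorem countable_isBesselRational (ν : ℝ) : {z | IsBesselRational ν z}.Countable := by
  refine ((countable_normalizedBessel_zeros ν).image2 (countable_normalizedBessel_zeros ν)
    (fun a b => a / b)).mono ?_
  rintro z ⟨-, a, b, ha, hb, -, rfl⟩
  exact ⟨a, ha, b, hb, rfl⟩

/-! ### Sturm comparison and real zeros -/

/-- A function whose derivative dominates `1 / 4 + r ^ 2` cannot live on an interval of
length `7 > 2 * π`. -/
theorem not_riccati_growth {r r' : ℝ → ℝ} {x : ℝ}
    (hr : ∀ t ∈ Set.Icc x (x + 7), HasDerivAt r (r' t) t)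
    (hr' : ∀ t ∈ Set.Icc x (x + 7), 1 / 4 + r t ^ 2 ≤ r' t) : False := by
  -- `arctan (2 r)` has slope at least 1/2, so it would rise by 7/2, more than its range `π` allows.
  have hd : ∀ t ∈ Set.Icc x (x + 7), HasDerivAt (fun t => Real.arctan (2 * r t))
      (1 / (1 + (2 * r t) ^ 2) * (2 * r' t)) t := fun t ht => ((hr t ht).const_mul 2).arctan
  have hge := (convex_Icc x (x + 7)).mul_sub_le_image_sub_of_le_deriv (C := 1 / 2)
    (fun t ht => (hd t ht).continuousAt.continuousWithinAt)
    (fun t ht => (hd t (interior_subset ht)).differentiableAt.differentiableWithinAt)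
    (fun t ht => by
      have ht' := interior_subset ht
      rw [(hd t ht').deriv, one_div_mul_eq_div, le_div_iff₀ (by positivity)]
      nlinarith [hr' t ht'])
    x (by simp) (x + 7) (by simp) (by linarith)
  have h1 := Real.arctan_lt_pi_div_two (2 * r (x + 7))
  have h2 := Real.neg_pi_div_two_lt_arctan (2 * r x)
  have h3 := Real.pi_lt_d2
  linarith

/-- Sturm comparison for `t y'' + (2 ν + 1) y' + t y = 0`. -/
theorem exists_zero_of_bessel_ode {ν x : ℝ} {f f' f'' : ℝ → ℝ} (hx : 2 * |ν| + 1 ≤ x)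
    (hf : ∀ t, HasDerivAt f (f' t) t) (hf' : ∀ t, HasDerivAt f' (f'' t) t)
    (hode : ∀ t, t * f'' t + (2 * ν + 1) * f' t + t * f t = 0) :
    ∃ t ∈ Set.Icc x (x + 7), f t = 0 := by
  by_contra! hne
  have hpos : ∀ t ∈ Set.Icc x (x + 7), 2 * |ν| + 1 ≤ t := fun t ht => hx.trans ht.1
  -- Here `r = -u'/u` for `u = t^(ν+1/2) f`, which removes the first-order term: `u'' + (1 + (1/4 -
  -- ν²)/t²) u = 0`.
  refine not_riccati_growth (x := x) (r := fun t => -(f' t / f t) - (ν + 1 / 2) / t)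
    (r' := fun t => -((f'' t * f t - f' t * f' t) / f t ^ 2) - (-(ν + 1 / 2) / t ^ 2)) ?_ ?_
  · intro t ht
    have ht0 : t ≠ 0 := by linarith [hpos t ht, abs_nonneg ν]
    have h1 := ((hf' t).div (hf t) (hne t ht)).neg
    have h2 := (hasDerivAt_const t (ν + 1 / 2)).div (hasDerivAt_id t) ht0
    exact (h1.sub h2).congr_deriv (by simp)
  · intro t ht
    have ht1 := hpos t ht
    have htp : 0 < t := by linarith [abs_nonneg ν]
    have hft := hne t ht
    have hf2 : f'' t = -((2 * ν + 1) * f' t / t) - f t := by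
      have := hode t
      field_simp
      linarith
    have hq : -((f'' t * f t - f' t * f' t) / f t ^ 2) - (-(ν + 1 / 2) / t ^ 2) =
        (-(f' t / f t) - (ν + 1 / 2) / t) ^ 2 + (1 + (1 / 4 - ν ^ 2) / t ^ 2) := by
      rw [hf2]
      field_simp
      ring
    have hb : (-3 / 4) ≤ (1 / 4 - ν ^ 2) / t ^ 2 := by
      rw [le_div_iff₀ (by positivity)]
      nlinarith [sq_abs ν, abs_nonneg ν]
    simp only [hq]
    linarith

theorem powerSum_besselCoeff_ofReal (ν w : ℝ) :
    ((powerSum (besselCoeff ν) w).re : ℂ) = powerSum (besselCoeff ν) w := by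
  have h : ∀ k, besselCoeff ν k * (w : ℂ) ^ k = (((besselCoeff ν k).re * w ^ k : ℝ) : ℂ) :=
    fun k => by
      push_cast
      rw [besselCoeff_ofReal]
  simp only [powerSum, h]
  rw [← Complex.ofReal_tsum, Complex.ofReal_re]

/-- For real order, `j_ν` has a real zero in every interval of length `7` far enough out. -/
theorem exists_real_zero_mem_Icc (ν : ℝ) {x : ℝ} (hx : 2 * |ν| + 1 ≤ x) :
    ∃ t ∈ Set.Icc x (x + 7), normalizedBessel ν (t : ℂ) = 0 := by
  have hc := entireCoeff_besselCoeff (ν : ℂ)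
  set g : ℝ → ℝ := fun w => (powerSum (besselCoeff ν) w).re with hg
  set g' : ℝ → ℝ := fun w => (powerSum (derivCoeff (besselCoeff ν)) w).re
  set g'' : ℝ → ℝ := fun w => (powerSum (derivCoeff (derivCoeff (besselCoeff ν))) w).re
  have d1 : ∀ w, HasDerivAt g (g' w) w := fun w => (hc.hasDerivAt w).real_of_complex
  have d2 : ∀ w, HasDerivAt g' (g'' w) w := fun w => (hc.derivCoeff.hasDerivAt w).real_of_complex
  have ode : ∀ w : ℝ, w * g'' w + (ν + 1) * g' w + g w = 0 := fun w => by
    have h := congrArg Complex.re (powerSum_besselCoeff_ode (ν : ℂ) (w : ℂ))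
    rw [← Complex.ofReal_one, ← Complex.ofReal_add, Complex.add_re, Complex.add_re,
      Complex.re_ofReal_mul, Complex.re_ofReal_mul, Complex.zero_re] at h
    exact h
  have dq : ∀ t : ℝ, HasDerivAt (fun t : ℝ => (t / 2) ^ 2) (t / 2) t := fun t => by
    exact (((hasDerivAt_id t).div_const 2).pow 2).congr_deriv (by simp; ring)
  obtain ⟨t, ht, h0⟩ := exists_zero_of_bessel_ode (ν := ν) (f := fun t => g ((t / 2) ^ 2))
    (f' := fun t => g' ((t / 2) ^ 2) * (t / 2))
    (f'' := fun t => g'' ((t / 2) ^ 2) * (t / 2) * (t / 2) + g' ((t / 2) ^ 2) * (1 / 2)) hx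
    (fun t => (d1 _).comp t (dq t))
    (fun t => ((d2 _).comp t (dq t)).mul ((hasDerivAt_id t).div_const 2))
    -- Substituting `w = (t/2)²` turns the equation in `w`, times `t`, into the one in `t`.
    (fun t => by linear_combination t * ode ((t / 2) ^ 2))
  refine ⟨t, ht, ?_⟩
  have h := powerSum_besselCoeff_ofReal ν ((t / 2) ^ 2)
  rw [normalizedBessel_eq]
  push_cast at h
  rw [← h]
  have h0' : g ((t / 2) ^ 2) = 0 := h0
  simp only [hg] at h0'
  push_cast at h0'
  rw [h0', Complex.ofReal_zero]

/-! ### Density of quotients and Baire category -/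

/-- Quotients of real zeros of `j_ν` with large denominators are dense in the real line. -/
theorem exists_zero_div_zero_near (ν x : ℝ) {δ : ℝ} (hδ : 0 < δ) :
    ∃ a b : ℝ, normalizedBessel ν (a : ℂ) = 0 ∧ normalizedBessel ν (b : ℂ) = 0 ∧ 1 < b ∧
      |x - a / b| < δ := by
  set X := 2 * |ν| + 1
  have hX1 : 1 ≤ X := by linarith [abs_nonneg ν]
  have hq : 0 < (X + 7) / δ := by positivity
  -- The numerator will lie within `X + 7` of `|x| * b`, so `b > (X + 7) / δ` makes the error less
  -- than `δ`.
  obtain ⟨b, hb, hb0⟩ := exists_real_zero_mem_Icc ν (x := X + (X + 7) / δ) (by linarith)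
  have hb1 : 1 < b := by linarith [hb.1]
  have hbp : 0 < b := by linarith
  have hbδ : X + 7 < δ * b := by
    have : (X + 7) / δ < b := by linarith [hb.1]
    rwa [div_lt_iff₀' hδ] at this
  obtain ⟨a, ha, ha0⟩ := exists_real_zero_mem_Icc ν (x := X + |x| * b)
    (by nlinarith [abs_nonneg x])
  have key : |(|x| - a / b)| < δ := by
    have e : |x| - a / b = (|x| * b - a) / b := by field_simp
    rw [e, abs_div, abs_of_pos hbp, div_lt_iff₀ hbp, abs_lt]
    constructor <;> linarith [ha.1, ha.2]
  rcases le_total 0 x with h | h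
  · exact ⟨a, b, ha0, hb0, hb1, by rwa [abs_of_nonneg h] at key⟩
  · refine ⟨-a, b, ?_, hb0, hb1, ?_⟩
    · rw [Complex.ofReal_neg, normalizedBessel_neg, ha0]
    · rw [abs_of_nonpos h, ← abs_neg] at key
      convert key using 2
      ring

theorem mem_residual_isBesselLiouville (ν : ℝ) :
    {x : ℝ | IsBesselLiouville (ν : ℂ) (x : ℂ)} ∈ residual ℝ := by
  have hopen : ∀ N : ℕ, {x : ℝ | ∃ a b : ℂ, normalizedBessel ν a = 0 ∧ normalizedBessel ν b = 0 ∧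
      1 < ‖b‖ ∧ ‖(x : ℂ) - a / b‖ < 1 / ‖b‖ ^ N} ∈ residual ℝ := fun N => by
    refine residual_of_dense_open ?_ ?_
    · simp only [Set.ofPred_exists, Set.ofPred_and]
      refine isOpen_iUnion fun a => isOpen_iUnion fun b => isOpen_const.inter
        (isOpen_const.inter (isOpen_const.inter (isOpen_lt (by fun_prop) continuous_const)))
    · refine Metric.dense_iff.mpr fun x δ hδ => ?_
      obtain ⟨a, b, ha, hb, hb1, hab⟩ := exists_zero_div_zero_near ν x hδ
      have hb1' : 1 < ‖(b : ℂ)‖ := by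
        rw [Complex.norm_real]; exact hb1.trans_le (le_abs_self b)
      -- The quotient itself is the point: its error is 0, whatever `N` is.
      refine ⟨a / b, ?_, a, b, ha, hb, hb1', ?_⟩
      · rwa [Metric.mem_ball, dist_comm, Real.dist_eq]
      · rw [Complex.ofReal_div, sub_self, norm_zero]
        positivity
  have hcount : {x : ℝ | IsBesselRational ν (x : ℂ)}.Countable :=
    (countable_isBesselRational ν).preimage Complex.ofReal_injective
  have hrat : {x : ℝ | IsBesselRational ν (x : ℂ)}ᶜ ∈ residual ℝ :=
    residual_of_dense_Gδ hcount.isGδ_compl (hcount.dense_compl ℝ)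
  filter_upwards [hrat, countable_iInter_mem.mpr hopen] with x h1 h2
  exact ⟨h1, Set.mem_iInter.mp h2⟩

theorem mainTheorem7 (ν : ℝ) :
    ¬ {x : ℝ | IsBesselLiouville (ν : ℂ) (x : ℂ)}.Countable ∧
      Dense {x : ℝ | IsBesselLiouville (ν : ℂ) (x : ℂ)} := by
  have h := mem_residual_isBesselLiouville ν
  refine ⟨fun hc => ?_, dense_of_mem_residual h⟩
  -- If the set were countable, it and its complement would both be residual, though disjoint.
  have hcompl := residual_of_dense_Gδ hc.isGδ_compl (hc.dense_compl ℝ)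
  have hne := (dense_of_mem_residual (inter_mem h hcompl)).nonempty
  simp at hne
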